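/- Let $n\ge 3$ be an integer and let $N_1,N_2$ be integers with $-N_1\le N_2$ (in particular, any $N_1,N_2\ge 0$). Let $R=\mathbb{C}[\lambda^i[k] : 1\le i\le n,\ -N_1\le k\le N_2]$ be the polynomial algebra, and for $-2N_1\le l\le 2N_2$ put \[ f[l]=\sum_{\substack{s+t=l\\ -N_1\le s,t\le N_2}}\ \sum_{i=1}^n \lambda^i[s]\,\lambda^i[t]\in R . \] Let $AQ_{-N_1}^{N_2}(n)=R/(f[-2N_1],\dots,f[2N_2])$ be the quasimap algebra. Let $C_{-N_1}^{N_2}(n)=R\otimes_{\mathbb C}\Lambda[c[l] : -2N_1\le l\le 2N_2]$ be the truncated mini-BRST (Koszul) complex, where each odd variable $c[l]$ has degree one, with the $R$-linear differential $d=\sum_{l=-2N_1}^{2N_2} f[l]\,\frac{\partial}{\partial c[l]}$, which lowers the degree by one. Then: (1) the cohomology of $C_{-N_1}^{N_2}(n)$ vanishes in every nonzero degree; (2) the degree-zero cohomology of $C_{-N_1}^{N_2}(n)$ is isomorphic to $AQ_{-N_1}^{N_2}(n)$; the isomorphism is $R$-linear and is induced by the algebra homomorphism $\zeta: C_{-N_1}^{N_2}(n)\to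 AQ_{-N_1}^{N_2}(n)$, $\lambda^i[k]\mapsto\lambda^i[k]$, $c[l]\mapsto 0$; (3) the $2(N_1+N_2)+1$ elements $f[-2N_1],f[-2N_1+1],\dots,f[2N_2]$ form a regular sequence in $R$. -/

import Mathlib

open CategoryTheory

namespace Quasimap

noncomputable section

/-- The set of even variables `λ^i[k]`, `1 ≤ i ≤ n`, `-N₁ ≤ k ≤ N₂`. -/
abbrev EvenIndex (n : ℕ) (N₁ N₂ : ℤ) : Type := Fin n × Set.Icc (-N₁) N₂

/-- The set of odd variables `c[l]`, `-2N₁ ≤ l ≤ 2N₂`. -/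
abbrev OddIndex (N₁ N₂ : ℤ) : Type := Set.Icc (-2 * N₁) (2 * N₂)

/-- The polynomial algebra `ℂ[λ^i[k]]`. -/
abbrev PolyRing (n : ℕ) (N₁ N₂ : ℤ) : Type := MvPolynomial (EvenIndex n N₁ N₂) ℂ

/-- The Fourier mode `f[l] = ∑_{s + t = l} ∑_i λ^i[s] λ^i[t]` of the quadric `∑_i (λ^i(z))²`,
where `s` and `t` run over the integers from `-N₁` to `N₂`. -/
def relation (n : ℕ) (N₁ N₂ : ℤ) (l : ℤ) : PolyRing n N₁ N₂ :=
  ∑ s : Set.Icc (-N₁) N₂, ∑ t : Set.Icc (-N₁) N₂,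
    if (s : ℤ) + (t : ℤ) = l then
      ∑ i : Fin n, MvPolynomial.X (i, s) * MvPolynomial.X (i, t)
    else 0

/-- The list `f[-2N₁], f[-2N₁ + 1], …, f[2N₂]` of all `2(N₁ + N₂) + 1` relations. -/
def relationList (n : ℕ) (N₁ N₂ : ℤ) : List (PolyRing n N₁ N₂) :=
  List.ofFn fun j : Fin (2 * (N₁ + N₂) + 1).toNat => relation n N₁ N₂ (-2 * N₁ + (j : ℕ))

/-- The ideal generated by the relations `f[l]`, `-2N₁ ≤ l ≤ 2N₂`. -/
def relationIdeal (n : ℕ) (N₁ N₂ : ℤ) : Ideal (PolyRing n N₁ N₂) :=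
  Ideal.span (Set.range fun l : OddIndex N₁ N₂ => relation n N₁ N₂ l)

/-- The quasimap algebra `AQ`. -/
abbrev AQ (n : ℕ) (N₁ N₂ : ℤ) : Type := PolyRing n N₁ N₂ ⧸ relationIdeal n N₁ N₂

/-- The free module on the odd variables `c[l]`. -/
abbrev OddModule (n : ℕ) (N₁ N₂ : ℤ) : Type := OddIndex N₁ N₂ →₀ PolyRing n N₁ N₂

/-- The algebra `ℂ[λ^i[k]] ⊗ Λ[c[l]]`, as the exterior algebra over `ℂ[λ^i[k]]` of the free
module on the `c[l]`. -/
abbrev KoszulAlgebra (n : ℕ) (N₁ N₂ : ℤ) : Type :=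
  ExteriorAlgebra (PolyRing n N₁ N₂) (OddModule n N₁ N₂)

/-- The linear functional `c[l] ↦ f[l]`. -/
def relationFunctional (n : ℕ) (N₁ N₂ : ℤ) :
    Module.Dual (PolyRing n N₁ N₂) (OddModule n N₁ N₂) :=
  Finsupp.linearCombination (PolyRing n N₁ N₂) fun l : OddIndex N₁ N₂ => relation n N₁ N₂ l

/-- The differential `d = ∑_l f[l] ∂/∂c[l]`: the contraction with the functional `c[l] ↦ f[l]`,
that is, the odd `ℂ[λ^i[k]]`-linear derivation with `d c[l] = f[l]`. -/
def differential (n : ℕ) (N₁ N₂ : ℤ) :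
    KoszulAlgebra n N₁ N₂ →ₗ[PolyRing n N₁ N₂] KoszulAlgebra n N₁ N₂ :=
  CliffordAlgebra.contractLeft (Q := (0 : QuadraticForm (PolyRing n N₁ N₂) (OddModule n N₁ N₂)))
    (relationFunctional n N₁ N₂)

theorem differential_differential (n : ℕ) (N₁ N₂ : ℤ) (x : KoszulAlgebra n N₁ N₂) :
    differential n N₁ N₂ (differential n N₁ N₂ x) = 0 :=
  CliffordAlgebra.contractLeft_contractLeft (relationFunctional n N₁ N₂) x

theorem differential_ι_mul (n : ℕ) (N₁ N₂ : ℤ) (m : OddModule n N₁ N₂)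
    (x : KoszulAlgebra n N₁ N₂) :
    differential n N₁ N₂ (ExteriorAlgebra.ι (PolyRing n N₁ N₂) m * x) =
      relationFunctional n N₁ N₂ m • x -
        ExteriorAlgebra.ι (PolyRing n N₁ N₂) m * differential n N₁ N₂ x :=
  CliffordAlgebra.contractLeft_ι_mul (relationFunctional n N₁ N₂) m x

theorem differential_c (n : ℕ) (N₁ N₂ : ℤ) (l : OddIndex N₁ N₂) :
    differential n N₁ N₂ (ExteriorAlgebra.ι (PolyRing n N₁ N₂) (Finsupp.single l 1)) =
      algebraMap _ _ (relation n N₁ N₂ l) := by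
  have h := CliffordAlgebra.contractLeft_ι
    (Q := (0 : QuadraticForm (PolyRing n N₁ N₂) (OddModule n N₁ N₂)))
    (relationFunctional n N₁ N₂) (Finsupp.single l 1)
  refine h.trans ?_
  simp [relationFunctional]

/-- The differential lowers the degree in the odd variables by one. -/
theorem differential_mem (n : ℕ) (N₁ N₂ : ℤ) (p : ℕ) (x : KoszulAlgebra n N₁ N₂)
    (hx : x ∈ ⋀[PolyRing n N₁ N₂]^(p + 1) (OddModule n N₁ N₂)) :
    differential n N₁ N₂ x ∈ ⋀[PolyRing n N₁ N₂]^p (OddModule n N₁ N₂) := by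
  induction p generalizing x with
  | zero =>
    rw [ExteriorAlgebra.exteriorPower, zero_add, pow_one] at hx
    obtain ⟨m, rfl⟩ := hx
    have h := differential_ι_mul n N₁ N₂ m 1
    have h1 : differential n N₁ N₂ 1 = 0 :=
      CliffordAlgebra.contractLeft_one _ (relationFunctional n N₁ N₂)
    rw [mul_one, h1, mul_zero, sub_zero] at h
    rw [h, ExteriorAlgebra.exteriorPower, pow_zero]
    exact Submodule.smul_mem _ _ (Submodule.one_le.mp le_rfl)
  | succ p ih =>
    rw [ExteriorAlgebra.exteriorPower, pow_succ'] at hx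
    induction hx using Submodule.mul_induction_on' with
    | mem_mul_mem a ha b hb =>
      obtain ⟨m, rfl⟩ := ha
      rw [differential_ι_mul]
      refine Submodule.sub_mem _ (Submodule.smul_mem _ _ hb) ?_
      rw [ExteriorAlgebra.exteriorPower, pow_succ']
      exact Submodule.mul_mem_mul ⟨m, rfl⟩ (ih b hb)
    | add a _ b _ iha ihb =>
      rw [map_add]
      exact Submodule.add_mem _ iha ihb

/-- The degree `p + 1` to degree `p` component of the differential. -/
def differentialComponent (n : ℕ) (N₁ N₂ : ℤ) (p : ℕ) :
    ⋀[PolyRing n N₁ N₂]^(p + 1) (OddModule n N₁ N₂) →ₗ[PolyRing n N₁ N₂]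
      ⋀[PolyRing n N₁ N₂]^p (OddModule n N₁ N₂) :=
  (differential n N₁ N₂).restrict (differential_mem n N₁ N₂ p)

/-- The truncated mini-BRST (Koszul) complex `C`, graded by the degree in the odd variables. -/
def koszulComplex (n : ℕ) (N₁ N₂ : ℤ) : ChainComplex (ModuleCat (PolyRing n N₁ N₂)) ℕ :=
  ChainComplex.of
    (fun p => ModuleCat.of (PolyRing n N₁ N₂) (⋀[PolyRing n N₁ N₂]^p (OddModule n N₁ N₂)))
    (fun p => ModuleCat.ofHom (differentialComponent n N₁ N₂ p))
    (fun p => by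
      refine ModuleCat.hom_ext (LinearMap.ext fun x => Subtype.ext ?_)
      exact differential_differential n N₁ N₂ x)

/-- The algebra homomorphism `ζ : C → AQ`, `λ^i[k] ↦ λ^i[k]`, `c[l] ↦ 0`. -/
def augmentation (n : ℕ) (N₁ N₂ : ℤ) :
    KoszulAlgebra n N₁ N₂ →ₐ[PolyRing n N₁ N₂] AQ n N₁ N₂ :=
  ExteriorAlgebra.lift (PolyRing n N₁ N₂)
    ⟨(0 : OddModule n N₁ N₂ →ₗ[PolyRing n N₁ N₂] AQ n N₁ N₂), fun _ => by simp⟩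

/-- The restriction of `ζ` to the degree-zero term of the complex. -/
def augmentationZero (n : ℕ) (N₁ N₂ : ℤ) :
    (koszulComplex n N₁ N₂).X 0 ⟶ ModuleCat.of (PolyRing n N₁ N₂) (AQ n N₁ N₂) :=
  ModuleCat.ofHom ((augmentation n N₁ N₂).toLinearMap.comp
    (⋀[PolyRing n N₁ N₂]^0 (OddModule n N₁ N₂)).subtype)

end

end Quasimap

-- Over ℂ, a linear change of variables replaces `x₀² + x₁²` by `4 x₀ x₁`, so the quadric becomes `4
-- x₀ x₁ + x₂² + ⋯`; this uses three of the `n ≥ 3` coordinates. Give `x₀[k]`, `x₁[k]` and `xᵢ[k]`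
-- with `i ≥ 2` the indices `2k + 1`, `2k - 1` and `2k`. Every monomial of the transformed `f[l]` is
-- a product of two variables with indices `a + b = 2l`, and `a² + b² = 2l² + 2(a - l)²` is least
-- exactly when `a = b = l`. A weight that decreases with the squares of the indices, and penalizes
-- `i ≥ 3`, therefore selects the leading monomial `x₂[l/2]²` for even `l` and `x₀[(l-1)/2]
-- x₁[(l+1)/2]` for odd `l`. Each variable has only one index, so these leading monomials are
-- pairwise coprime.
--
-- Coprime leading monomials make a family regular in every order
-- (`MonomialOrder.mem_span_of_mul_mem_span`): by division with remainder, leading terms cannot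
-- cancel. This gives (3) directly. It also gives (1), by adding the odd variables one at a time
-- (`ExteriorAlgebra.exists_koszulD_eq`). Claim (2) holds without regularity: degree-zero homology
-- is the cokernel of `d`, whose image is the ideal of relations.

universe u

/-! ### Weighted monomial orders and coprime leading monomials -/

namespace MonomialOrder

open MvPolynomial

variable {σ : Type*}

/-- The type `σ →₀ ℕ`, to be ordered by the weight `w` and then by the monomial order `m`. -/
@[nolint unusedArguments]
def WeightedSyn (_m : MonomialOrder σ) (_w : (σ →₀ ℕ) →+ ℕ) : Type _ := σ →₀ ℕ

noncomputable instance (m : MonomialOrder σ) (w : (σ →₀ ℕ) →+ ℕ) :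
    AddCommMonoid (WeightedSyn m w) :=
  inferInstanceAs (AddCommMonoid (σ →₀ ℕ))

/-- The pair consisting of the weight and the position in the tie-breaking order. -/
noncomputable def weightedKey (m : MonomialOrder σ) (w : (σ →₀ ℕ) →+ ℕ)
    (a : WeightedSyn m w) : ℕ ×ₗ m.syn :=
  toLex (w a, m.toSyn a)

theorem weightedKey_injective (m : MonomialOrder σ) (w : (σ →₀ ℕ) →+ ℕ) :
    Function.Injective (weightedKey m w) := fun a b h => by
  have h2 := congrArg (fun x => (ofLex x).2) h
  exact m.toSyn.injective h2

noncomputable instance (m : MonomialOrder σ) (w : (σ →₀ ℕ) →+ ℕ) :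
    LinearOrder (WeightedSyn m w) :=
  LinearOrder.lift' (weightedKey m w) (weightedKey_injective m w)

theorem weightedKey_add (m : MonomialOrder σ) (w : (σ →₀ ℕ) →+ ℕ) (a b : WeightedSyn m w) :
    weightedKey m w (a + b) = weightedKey m w a + weightedKey m w b := by
  have h1 : w (a + b : σ →₀ ℕ) = w a + w b := map_add w _ _
  have h2 : m.toSyn (a + b : σ →₀ ℕ) = m.toSyn a + m.toSyn b := map_add m.toSyn _ _
  exact congrArg toLex (Prod.ext h1 h2)

instance (m : MonomialOrder σ) (w : (σ →₀ ℕ) →+ ℕ) : IsOrderedAddMonoid (WeightedSyn m w) where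
  add_le_add_left a b h c := by
    change weightedKey m w (a + c) ≤ weightedKey m w (b + c)
    rw [weightedKey_add, weightedKey_add]
    have h' : weightedKey m w a ≤ weightedKey m w b := h
    gcongr

instance (m : MonomialOrder σ) (w : (σ →₀ ℕ) →+ ℕ) : WellFoundedLT (WeightedSyn m w) :=
  ⟨InvImage.wf (weightedKey m w) wellFounded_lt⟩

/-- The refinement of a weight by a monomial order. -/
noncomputable def weighted (m : MonomialOrder σ) (w : (σ →₀ ℕ) →+ ℕ) : MonomialOrder σ where
  syn := WeightedSyn m w
  toSyn := { toEquiv := Equiv.refl _, map_add' := fun _ _ => rfl }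
  toSyn_monotone a b h := by
    change toLex (w a, m.toSyn a) ≤ toLex (w b, m.toSyn b)
    refine Prod.Lex.toLex_mono ⟨?_, m.toSyn_monotone h⟩
    obtain ⟨c, rfl⟩ := exists_add_of_le h
    simp

/-- The leading monomials below are found by weight alone, so the choice of the tie-breaking order
`m` is immaterial. -/
theorem weighted_lt_of_lt (m : MonomialOrder σ) (w : (σ →₀ ℕ) →+ ℕ) {a b : σ →₀ ℕ}
    (h : w a < w b) : a ≺[m.weighted w] b :=
  (Prod.Lex.toLex_lt_toLex (x := (w a, m.toSyn a)) (y := (w b, m.toSyn b))).2 (Or.inl h)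

theorem exists_of_finite (σ : Type u) [Finite σ] : Nonempty (MonomialOrder.{u, u} σ) := by
  classical
  let _ : LinearOrder σ := linearOrderOfSTO WellOrderingRel
  exact ⟨MonomialOrder.lex⟩

variable {k : Type*} [Field k] {ι : Type*}

/-- A polynomial that is a nonzero multiple of a monomial plus terms of smaller weight has this
monomial as its degree. -/
theorem degree_eq_of_sub_monomial (m : MonomialOrder σ) {f : MvPolynomial σ k} {d : σ →₀ ℕ}
    {c : k} (hc : c ≠ 0) (h : ∀ a ∈ (f - monomial d c).support, a ≺[m] d) :
    m.degree f = d := by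
  classical
  have hd : coeff d f ≠ 0 := by
    have : coeff d (f - monomial d c) = 0 := by
      by_contra hne
      exact lt_irrefl _ (h d (mem_support_iff.2 hne))
    rw [coeff_sub, coeff_monomial, if_pos rfl, sub_eq_zero] at this
    rwa [this]
  have h1 : m.toSyn d ≤ m.toSyn (m.degree f) := m.le_degree (mem_support_iff.2 hd)
  have h2 : m.toSyn (m.degree f) ≤ m.toSyn d := by
    rw [degree_le_iff]
    intro b hb
    by_cases hbd : b = d
    · rw [hbd]
    · refine (h b ?_).le
      rw [mem_support_iff, coeff_sub, coeff_monomial, if_neg (Ne.symm hbd), sub_zero]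
      exact mem_support_iff.1 hb
  exact m.toSyn.injective (le_antisymm h2 h1)

/-- Division with remainder by a finite subfamily, in terms of the ideal that it spans. -/
theorem exists_sub_mem_span (m : MonomialOrder σ) {f : ι → MvPolynomial σ k}
    (hf : ∀ i, f i ≠ 0) (s : Set ι) (g : MvPolynomial σ k) :
    ∃ r, g - r ∈ Ideal.span (f '' s) ∧ ∀ c ∈ r.support, ∀ i ∈ s, ¬ m.degree (f i) ≤ c := by
  obtain ⟨q, r, h, -, hr⟩ := m.div (b := fun i : s => f i)
    (fun i => isUnit_leadingCoeff.2 (hf i)) g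
  refine ⟨r, ?_, fun c hc i hi => hr c hc ⟨i, hi⟩⟩
  rw [h, add_sub_cancel_right, Finsupp.linearCombination_apply]
  exact Ideal.sum_mem _ fun i _ => Ideal.mul_mem_left _ _
    (Ideal.subset_span (Set.mem_image_of_mem f i.2))

/-- At each variable one of the exponents of `a` and `b` is zero. This is Euclid's lemma for coprime
monomials. -/
theorem le_of_le_add_of_disjoint {a b c : σ →₀ ℕ} (hab : Disjoint a b) (h : a ≤ c + b) :
    a ≤ c := by
  intro i
  have h1 := DFunLike.congr_fun (disjoint_iff.1 hab) i
  have h2 := h i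
  simp only [Finsupp.inf_apply, _root_.bot_eq_zero, Finsupp.coe_zero, Pi.zero_apply,
    Finsupp.coe_add, Pi.add_apply] at h1 h2
  omega

/-- If the degrees of the `f i` are pairwise coprime monomials, then the degree of every nonzero
element of the ideal spanned by finitely many of them is divisible by one of these degrees. -/
theorem exists_degree_le_of_mem_span (m : MonomialOrder σ) {f : ι → MvPolynomial σ k}
    (hf : ∀ i, f i ≠ 0) (hd : Pairwise fun i j => Disjoint (m.degree (f i)) (m.degree (f j)))
    (s : Finset ι) {h : MvPolynomial σ k} (hs : h ∈ Ideal.span (f '' s)) (h0 : h ≠ 0) :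
    ∃ i ∈ s, m.degree (f i) ≤ m.degree h := by
  classical
  induction s using Finset.induction_on generalizing h with
  | empty => simp at hs; exact absurd hs h0
  | insert j s hj ih =>
    rw [Finset.coe_insert, Set.image_insert_eq, Ideal.mem_span_insert] at hs
    obtain ⟨g', a', ha', rfl⟩ := hs
    -- Reduce the cofactor of `f j` modulo the family on `s`; the difference is absorbed into the
    -- part `a` lying in the ideal of `s`.
    obtain ⟨g, hg, hgr⟩ := m.exists_sub_mem_span hf s g'
    obtain ⟨a, ha, hag⟩ : ∃ a ∈ Ideal.span (f '' s), g' * f j + a' = a + g * f j :=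
      ⟨a' + (g' - g) * f j, Ideal.add_mem _ ha' (Ideal.mul_mem_right _ _ hg), by ring⟩
    rw [hag] at h0 ⊢
    rcases eq_or_ne g 0 with rfl | hg0
    · rw [zero_mul, add_zero] at h0 ⊢
      obtain ⟨i, hi, hle⟩ := ih ha h0
      exact ⟨i, Finset.mem_insert_of_mem hi, hle⟩
    have hdeg : m.degree (g * f j) = m.degree g + m.degree (f j) := degree_mul hg0 (hf j)
    have hjle : m.degree (f j) ≤ m.degree (g * f j) := hdeg ▸ le_add_self
    rcases eq_or_ne a 0 with rfl | ha0
    · exact ⟨j, Finset.mem_insert_self _ _, by rwa [zero_add]⟩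
    obtain ⟨i, hi, hle⟩ := ih ha ha0
    have hij : i ≠ j := fun e => hj (e ▸ hi)
    -- The leading terms cannot cancel: if the degrees agreed, some `m.degree (f i)` would divide
    -- that of `g * f j`, hence that of `g` by coprimality, although `g` is reduced.
    have hne : m.degree a ≠ m.degree (g * f j) := fun e => by
      rw [e, hdeg] at hle
      exact hgr _ (m.degree_mem_support hg0) i hi (le_of_le_add_of_disjoint (hd hij) hle)
    rcases lt_or_gt_of_ne (m.toSyn.injective.ne hne) with hlt | hlt
    · exact ⟨j, Finset.mem_insert_self _ _, by rwa [degree_add_eq_right_of_lt hlt]⟩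
    · exact ⟨i, Finset.mem_insert_of_mem hi, by rwa [degree_add_of_lt hlt]⟩

/-- Polynomials with pairwise coprime degrees form a regular sequence in every order. -/
theorem mem_span_of_mul_mem_span (m : MonomialOrder σ) {f : ι → MvPolynomial σ k}
    (hf : ∀ i, f i ≠ 0) (hd : Pairwise fun i j => Disjoint (m.degree (f i)) (m.degree (f j)))
    (s : Finset ι) {j : ι} (hj : j ∉ s) {g : MvPolynomial σ k}
    (hg : g * f j ∈ Ideal.span (f '' s)) : g ∈ Ideal.span (f '' s) := by
  -- The remainder `r` satisfies the same hypothesis as `g`; if it were nonzero, its leading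
  -- monomial would be divisible by the degree of some `f i` with `i ∈ s`.
  obtain ⟨r, hr, hrs⟩ := m.exists_sub_mem_span hf s g
  rcases eq_or_ne r 0 with rfl | hr0
  · rwa [sub_zero] at hr
  exfalso
  have hrf : r * f j ∈ Ideal.span (f '' s) := by
    have := Ideal.sub_mem _ hg (Ideal.mul_mem_right (f j) _ hr)
    rwa [← sub_mul, sub_sub_cancel] at this
  obtain ⟨i, hi, hle⟩ := m.exists_degree_le_of_mem_span hf hd s hrf (mul_ne_zero hr0 (hf j))
  rw [degree_mul hr0 (hf j)] at hle
  exact hrs _ (m.degree_mem_support hr0) i hi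
    (le_of_le_add_of_disjoint (hd fun e : i = j => hj (e ▸ hi)) hle)

end MonomialOrder

/-! ### Acyclicity of the Koszul complex -/

namespace ExteriorAlgebra

variable {R : Type*} [CommRing R] {ι : Type*}

/-- The degree `p` part of the exterior algebra on the basis vectors indexed by `s`. -/
noncomputable def coordPower (R : Type*) [CommRing R] {ι : Type*} (s : Set ι) (p : ℕ) :
    Submodule R (ExteriorAlgebra R (ι →₀ R)) :=
  (Submodule.span R ((fun i => ExteriorAlgebra.ι R (Finsupp.single i (1 : R))) '' s)) ^ p

/-- The Koszul differential of the family `f`. -/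
noncomputable def koszulD (f : ι → R) :
    ExteriorAlgebra R (ι →₀ R) →ₗ[R] ExteriorAlgebra R (ι →₀ R) :=
  CliffordAlgebra.contractLeft (Q := (0 : QuadraticForm R (ι →₀ R)))
    (Finsupp.linearCombination R f)

theorem koszulD_ι_single_mul (f : ι → R) (i : ι) (x : ExteriorAlgebra R (ι →₀ R)) :
    koszulD f (ExteriorAlgebra.ι R (Finsupp.single i (1 : R)) * x) =
      f i • x - ExteriorAlgebra.ι R (Finsupp.single i (1 : R)) * koszulD f x := by
  have h := CliffordAlgebra.contractLeft_ι_mul (Q := (0 : QuadraticForm R (ι →₀ R)))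
    (Finsupp.linearCombination R f) (Finsupp.single i (1 : R)) x
  rw [Finsupp.linearCombination_single, one_smul] at h
  exact h

theorem koszulD_one (f : ι → R) : koszulD f 1 = 0 :=
  CliffordAlgebra.contractLeft_one _ _

theorem koszulD_ι_single (f : ι → R) (i : ι) :
    koszulD f (ExteriorAlgebra.ι R (Finsupp.single i (1 : R))) = f i • 1 := by
  have h := koszulD_ι_single_mul f i 1
  rwa [mul_one, koszulD_one, mul_zero, sub_zero] at h

theorem coordPower_zero (s : Set ι) : coordPower R s 0 = 1 := pow_zero _

theorem coordPower_mono {s t : Set ι} (h : s ⊆ t) (p : ℕ) : coordPower R s p ≤ coordPower R t p :=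
  pow_le_pow_left' (Submodule.span_mono (Set.image_mono h)) p

theorem ι_single_mul_mem {s : Set ι} {i : ι} (hi : i ∈ s) {p : ℕ}
    {x : ExteriorAlgebra R (ι →₀ R)} (hx : x ∈ coordPower R s p) :
    ExteriorAlgebra.ι R (Finsupp.single i (1 : R)) * x ∈ coordPower R s (p + 1) := by
  rw [coordPower, pow_succ']
  exact Submodule.mul_mem_mul (Submodule.subset_span ⟨i, hi, rfl⟩) hx

/-- Reduces a property stable under linear combinations to products with a single basis vector, the
form to which the Leibniz rule for `koszulD` applies. -/
theorem coordPower_induction {s : Set ι} {p : ℕ}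
    {P : ExteriorAlgebra R (ι →₀ R) → Prop}
    (hmul : ∀ i ∈ s, ∀ x ∈ coordPower R s p,
      P (ExteriorAlgebra.ι R (Finsupp.single i (1 : R)) * x))
    (hadd : ∀ x y, P x → P y → P (x + y)) (hsmul : ∀ (r : R) x, P x → P (r • x)) (h0 : P 0)
    {x : ExteriorAlgebra R (ι →₀ R)} (hx : x ∈ coordPower R s (p + 1)) : P x := by
  rw [coordPower, pow_succ'] at hx
  induction hx using Submodule.mul_induction_on' with
  | mem_mul_mem a ha b hb =>
    induction ha using Submodule.span_induction with
    | mem a ha => obtain ⟨i, hi, rfl⟩ := ha; exact hmul i hi b hb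
    | zero => rwa [zero_mul]
    | add a a' _ _ h h' => rw [add_mul]; exact hadd _ _ h h'
    | smul r a _ h => rw [smul_mul_assoc]; exact hsmul _ _ h
  | add a _ b _ iha ihb => exact hadd _ _ iha ihb

theorem koszulD_mem_coordPower (f : ι → R) (s : Set ι) (p : ℕ)
    {x : ExteriorAlgebra R (ι →₀ R)} (hx : x ∈ coordPower R s (p + 1)) :
    koszulD f x ∈ coordPower R s p := by
  induction p generalizing x with
  | zero =>
    refine coordPower_induction (P := fun x => koszulD f x ∈ coordPower R s 0) ?_
      (fun x y h h' => by rw [map_add]; exact Submodule.add_mem _ h h')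
      (fun r x h => by rw [map_smul]; exact Submodule.smul_mem _ _ h)
      (by rw [map_zero]; exact Submodule.zero_mem _) hx
    intro i _ y hy
    rw [coordPower_zero, Submodule.mem_one] at hy
    obtain ⟨r, rfl⟩ := hy
    rw [koszulD_ι_single_mul, Algebra.algebraMap_eq_smul_one, map_smul, koszulD_one, smul_zero,
      mul_zero, sub_zero, coordPower_zero]
    exact Submodule.smul_mem _ _ (Submodule.smul_mem _ _ (Submodule.one_le.1 le_rfl))
  | succ p ih =>
    refine coordPower_induction (P := fun x => koszulD f x ∈ coordPower R s (p + 1)) ?_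
      (fun x y h h' => by rw [map_add]; exact Submodule.add_mem _ h h')
      (fun r x h => by rw [map_smul]; exact Submodule.smul_mem _ _ h)
      (by rw [map_zero]; exact Submodule.zero_mem _) hx
    intro i hi y hy
    rw [koszulD_ι_single_mul]
    exact Submodule.sub_mem _ (Submodule.smul_mem _ _ hy) (ι_single_mul_mem hi (ih hy))

/-- Contraction with a coordinate outside `s` kills the exterior algebra on `s`. -/
theorem koszulD_eq_zero_of_eqOn (f : ι → R) {s : Set ι} (hf : ∀ i ∈ s, f i = 0) (p : ℕ)
    {x : ExteriorAlgebra R (ι →₀ R)} (hx : x ∈ coordPower R s p) : koszulD f x = 0 := by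
  induction p generalizing x with
  | zero =>
    rw [coordPower_zero, Submodule.mem_one] at hx
    obtain ⟨r, rfl⟩ := hx
    rw [Algebra.algebraMap_eq_smul_one, map_smul, koszulD_one, smul_zero]
  | succ p ih =>
    refine coordPower_induction (P := fun x => koszulD f x = 0) ?_
      (fun x y h h' => by rw [map_add, h, h', add_zero])
      (fun r x h => by rw [map_smul, h, smul_zero]) (map_zero _) hx
    intro i hi y hy
    rw [koszulD_ι_single_mul, hf i hi, ih hy, zero_smul, mul_zero, sub_zero]

/-- Splitting off one basis vector. -/
theorem exists_add_ι_single_mul (s : Set ι) (j : ι) (p : ℕ) {x : ExteriorAlgebra R (ι →₀ R)}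
    (hx : x ∈ coordPower R (insert j s) (p + 1)) :
    ∃ a ∈ coordPower R s (p + 1), ∃ b ∈ coordPower R s p,
      x = a + ExteriorAlgebra.ι R (Finsupp.single j (1 : R)) * b := by
  induction p generalizing x with
  | zero =>
    refine coordPower_induction (P := fun x => ∃ a ∈ coordPower R s (0 + 1),
      ∃ b ∈ coordPower R s 0, x = a + ExteriorAlgebra.ι R (Finsupp.single j (1 : R)) * b) ?_
      ?_ ?_ ?_ hx
    · intro i hi y hy
      rw [coordPower_zero, ← coordPower_zero s] at hy
      rcases hi with rfl | hi
      · exact ⟨0, Submodule.zero_mem _, y, hy, (zero_add _).symm⟩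
      · exact ⟨_, ι_single_mul_mem hi hy, 0, Submodule.zero_mem _, by rw [mul_zero, add_zero]⟩
    · rintro x y ⟨a, ha, b, hb, rfl⟩ ⟨a', ha', b', hb', rfl⟩
      exact ⟨a + a', Submodule.add_mem _ ha ha', b + b', Submodule.add_mem _ hb hb', by
        rw [mul_add]; abel⟩
    · rintro r x ⟨a, ha, b, hb, rfl⟩
      exact ⟨r • a, Submodule.smul_mem _ _ ha, r • b, Submodule.smul_mem _ _ hb, by
        rw [smul_add, mul_smul_comm]⟩
    · exact ⟨0, Submodule.zero_mem _, 0, Submodule.zero_mem _, by rw [mul_zero, add_zero]⟩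
  | succ p ih =>
    refine coordPower_induction (P := fun x => ∃ a ∈ coordPower R s (p + 1 + 1),
      ∃ b ∈ coordPower R s (p + 1),
        x = a + ExteriorAlgebra.ι R (Finsupp.single j (1 : R)) * b) ?_ ?_ ?_ ?_ hx
    · intro i hi y hy
      obtain ⟨a, ha, b, hb, rfl⟩ := ih hy
      rcases hi with rfl | hi
      · refine ⟨0, Submodule.zero_mem _, a, ha, ?_⟩
        rw [mul_add, ← mul_assoc, ExteriorAlgebra.ι_sq_zero, zero_mul, add_zero, zero_add]
      · refine ⟨_, ι_single_mul_mem hi ha, -(ExteriorAlgebra.ι R (Finsupp.single i (1 : R)) * b),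
          Submodule.neg_mem _ (ι_single_mul_mem hi hb), ?_⟩
        have h := ExteriorAlgebra.ι_add_mul_swap (R := R) (Finsupp.single i (1 : R))
          (Finsupp.single j (1 : R))
        rw [mul_add, ← mul_assoc, eq_neg_of_add_eq_zero_left h, mul_neg, neg_mul, mul_assoc]
    · rintro x y ⟨a, ha, b, hb, rfl⟩ ⟨a', ha', b', hb', rfl⟩
      exact ⟨a + a', Submodule.add_mem _ ha ha', b + b', Submodule.add_mem _ hb hb', by
        rw [mul_add]; abel⟩
    · rintro r x ⟨a, ha, b, hb, rfl⟩
      exact ⟨r • a, Submodule.smul_mem _ _ ha, r • b, Submodule.smul_mem _ _ hb, by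
        rw [smul_add, mul_smul_comm]⟩
    · exact ⟨0, Submodule.zero_mem _, 0, Submodule.zero_mem _, by rw [mul_zero, add_zero]⟩

/-- The image of the degree one part is the ideal spanned by the corresponding `f i`. -/
theorem exists_koszulD_eq_smul_one (f : ι → R) (s : Set ι) {r : R}
    (hr : r ∈ Ideal.span (f '' s)) : ∃ y ∈ coordPower R s 1, koszulD f y = r • 1 := by
  induction hr using Submodule.span_induction with
  | mem r hr =>
    obtain ⟨i, hi, rfl⟩ := hr
    refine ⟨_, ?_, koszulD_ι_single f i⟩
    rw [coordPower, pow_one]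
    exact Submodule.subset_span ⟨i, hi, rfl⟩
  | zero => exact ⟨0, Submodule.zero_mem _, by rw [map_zero, zero_smul]⟩
  | add r r' _ _ h h' =>
    obtain ⟨y, hy, e⟩ := h
    obtain ⟨y', hy', e'⟩ := h'
    exact ⟨y + y', Submodule.add_mem _ hy hy', by rw [map_add, e, e', add_smul]⟩
  | smul a r _ h =>
    obtain ⟨y, hy, e⟩ := h
    exact ⟨a • y, Submodule.smul_mem _ _ hy, by rw [map_smul, e, smul_smul, smul_eq_mul]⟩

theorem exists_mem_span_koszulD_eq_smul_one (f : ι → R) (s : Set ι)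
    {y : ExteriorAlgebra R (ι →₀ R)} (hy : y ∈ coordPower R s 1) :
    ∃ r ∈ Ideal.span (f '' s), koszulD f y = r • 1 := by
  rw [coordPower, pow_one] at hy
  induction hy using Submodule.span_induction with
  | mem y hy =>
    obtain ⟨i, hi, rfl⟩ := hy
    exact ⟨f i, Ideal.subset_span ⟨i, hi, rfl⟩, koszulD_ι_single f i⟩
  | zero => exact ⟨0, Ideal.zero_mem _, by rw [map_zero, zero_smul]⟩
  | add y y' _ _ h h' =>
    obtain ⟨r, hr, e⟩ := h
    obtain ⟨r', hr', e'⟩ := h'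
    exact ⟨r + r', Ideal.add_mem _ hr hr', by rw [map_add, e, e', add_smul]⟩
  | smul a y _ h =>
    obtain ⟨r, hr, e⟩ := h
    exact ⟨a * r, Ideal.mul_mem_left _ _ hr, by rw [map_smul, e, smul_smul]⟩

theorem smul_one_injective {r r' : R}
    (h : r • (1 : ExteriorAlgebra R (ι →₀ R)) = r' • 1) : r = r' := by
  rw [← Algebra.algebraMap_eq_smul_one, ← Algebra.algebraMap_eq_smul_one] at h
  exact (ExteriorAlgebra.algebraMap_inj _ _ _).1 h

/-- The Koszul complex of a family that is a regular sequence in every order is acyclic in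
positive degrees. -/
theorem exists_koszulD_eq (f : ι → R)
    (hf : ∀ (s : Finset ι) (j : ι), j ∉ s → ∀ g : R,
      g * f j ∈ Ideal.span (f '' s) → g ∈ Ideal.span (f '' s))
    (s : Finset ι) (p : ℕ) {x : ExteriorAlgebra R (ι →₀ R)}
    (hx : x ∈ coordPower R (s : Set ι) (p + 1)) (h0 : koszulD f x = 0) :
    ∃ y ∈ coordPower R (s : Set ι) (p + 2), koszulD f y = x := by
  classical
  induction s using Finset.induction_on generalizing p x with
  | empty =>
    refine ⟨0, Submodule.zero_mem _, ?_⟩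
    rw [coordPower, Finset.coe_empty, Set.image_empty, Submodule.span_empty, pow_succ',
      Submodule.bot_mul, Submodule.mem_bot] at hx
    rw [hx, map_zero]
  | insert j s hj ih =>
    rw [Finset.coe_insert] at hx
    obtain ⟨a, ha, b, hb, rfl⟩ := exists_add_ι_single_mul _ _ _ hx
    set c := ExteriorAlgebra.ι R (Finsupp.single j (1 : R)) with hc
    rw [map_add, koszulD_ι_single_mul, ← hc] at h0
    -- Contraction with the coordinate form of `j` kills everything built from `s`. Applied to `d a
    -- + f j • b - c * d b = 0`, it isolates `d b = 0`, and then `d a + f j • b = 0` remains.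
    have hδ : ∀ i ∈ (s : Set ι), (Pi.single j 1 : ι → R) i = 0 := fun i hi =>
      Pi.single_eq_of_ne (by rintro rfl; exact hj hi) _
    have hDa := koszulD_mem_coordPower f _ _ ha
    have hDb : koszulD f b = 0 ∧ koszulD f a + f j • b = 0 := by
      have hDb0 : koszulD f b = 0 := by
        have h1 : koszulD (Pi.single j 1 : ι → R) (koszulD f b) = 0 := by
          cases p with
          | zero =>
            -- Here `b` is a scalar. The degree-zero part is the same for every index set, so `∅`
            -- makes the vanishing condition on `f` vacuous.
            rw [koszulD_eq_zero_of_eqOn (s := ∅) f (by simp) 0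
              (by rw [coordPower_zero] at hb ⊢; exact hb), map_zero]
          | succ p => exact koszulD_eq_zero_of_eqOn _ hδ _ (koszulD_mem_coordPower f _ _ hb)
        have h := congrArg (koszulD (Pi.single j 1 : ι → R)) h0
        rw [map_add, map_sub, map_smul, koszulD_eq_zero_of_eqOn _ hδ _ hDa,
          koszulD_eq_zero_of_eqOn _ hδ _ hb, koszulD_ι_single_mul, h1, Pi.single_eq_same,
          map_zero] at h
        simpa using h
      refine ⟨hDb0, ?_⟩
      rwa [hDb0, mul_zero, sub_zero] at h0
    -- For positive `p` this is the induction hypothesis. For `p = 0` the cycle `b` is a scalar `r`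
    -- with `r * f j` in the ideal of `s`, and regularity puts `r` itself there.
    obtain ⟨b', hb', hbb'⟩ : ∃ b' ∈ coordPower R (s : Set ι) (p + 1), koszulD f b' = b := by
      cases p with
      | zero =>
        rw [coordPower_zero, Submodule.mem_one] at hb
        obtain ⟨r, rfl⟩ := hb
        obtain ⟨r', hr', e⟩ := exists_mem_span_koszulD_eq_smul_one f _ ha
        have h := hDb.2
        rw [e, Algebra.algebraMap_eq_smul_one, smul_smul, ← add_smul,
          ← zero_smul R (1 : ExteriorAlgebra R (ι →₀ R))] at h
        have h' := smul_one_injective h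
        rw [Algebra.algebraMap_eq_smul_one]
        refine exists_koszulD_eq_smul_one f _ (hf s j hj r ?_)
        rw [mul_comm, eq_neg_of_add_eq_zero_right h']
        exact Submodule.neg_mem _ hr'
      | succ p => exact ih p hb hDb.1
    obtain ⟨a', ha', haa'⟩ := ih p (x := a + f j • b')
      (Submodule.add_mem _ ha (Submodule.smul_mem _ _ hb'))
      (by rw [map_add, map_smul, hbb', hDb.2])
    rw [Finset.coe_insert]
    have hsub : (s : Set ι) ⊆ insert j (s : Set ι) := Set.subset_insert _ _
    -- Since `d a' = a + f j • b'` and `d (c * b') = f j • b' - c * b`, the difference is `a + c *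
    -- b`.
    refine ⟨a' - c * b', Submodule.sub_mem _ (coordPower_mono hsub _ ha')
      (ι_single_mul_mem (Set.mem_insert _ _) (coordPower_mono hsub _ hb')), ?_⟩
    rw [map_sub, haa', hc, koszulD_ι_single_mul, hbb']
    abel

theorem coordPower_univ (p : ℕ) :
    coordPower R (Set.univ : Set ι) p = ⋀[R]^p (ι →₀ R) := by
  rw [coordPower, ExteriorAlgebra.exteriorPower]
  congr 1
  rw [Set.image_univ, LinearMap.range_eq_map, ← Finsupp.supported_univ,
    Finsupp.supported_eq_span_single, Submodule.map_span, Set.image_univ, ← Set.range_comp]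
  rfl

end ExteriorAlgebra

/-! ### Homology of the truncated mini-BRST complex -/

namespace Quasimap

theorem koszulComplex_d (n : ℕ) (N₁ N₂ : ℤ) (p : ℕ) :
    (koszulComplex n N₁ N₂).d (p + 1) p = ModuleCat.ofHom (differentialComponent n N₁ N₂ p) := by
  exact ChainComplex.of_d
    (fun p => ModuleCat.of (PolyRing n N₁ N₂) (⋀[PolyRing n N₁ N₂]^p (OddModule n N₁ N₂)))
    (fun p => ModuleCat.ofHom (differentialComponent n N₁ N₂ p)) p

theorem isZero_homology_koszulComplex (n : ℕ) (N₁ N₂ : ℤ)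
    (H : ∀ (s : Finset (OddIndex N₁ N₂)) (j : OddIndex N₁ N₂), j ∉ s → ∀ g : PolyRing n N₁ N₂,
      g * relation n N₁ N₂ j ∈ Ideal.span ((fun l : OddIndex N₁ N₂ => relation n N₁ N₂ l) '' s) →
      g ∈ Ideal.span ((fun l : OddIndex N₁ N₂ => relation n N₁ N₂ l) '' s))
    (p : ℕ) (hp : p ≠ 0) : Limits.IsZero ((koszulComplex n N₁ N₂).homology p) := by
  obtain ⟨p, rfl⟩ := Nat.exists_eq_succ_of_ne_zero hp
  rw [← HomologicalComplex.exactAt_iff_isZero_homology,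
    HomologicalComplex.exactAt_iff' _ (p + 2) (p + 1) p (by simp) (by simp),
    ShortComplex.moduleCat_exact_iff]
  intro x hx
  change (koszulComplex n N₁ N₂).d (p + 1) p x = 0 at hx
  change ∃ y, (koszulComplex n N₁ N₂).d (p + 2) (p + 1) y = x
  rw [koszulComplex_d] at hx ⊢
  have hx' : ExteriorAlgebra.koszulD (fun l : OddIndex N₁ N₂ => relation n N₁ N₂ l) x.1 = 0 :=
    congrArg Subtype.val hx
  have hmem : (x.1 : KoszulAlgebra n N₁ N₂) ∈ ExteriorAlgebra.coordPower (PolyRing n N₁ N₂)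
      ((Finset.univ : Finset (OddIndex N₁ N₂)) : Set (OddIndex N₁ N₂)) (p + 1) := by
    rw [Finset.coe_univ]
    exact (ExteriorAlgebra.coordPower_univ (p + 1)).ge x.2
  obtain ⟨y, hy, hyx⟩ := ExteriorAlgebra.exists_koszulD_eq _ H Finset.univ p hmem hx'
  rw [Finset.coe_univ, ExteriorAlgebra.coordPower_univ] at hy
  exact ⟨⟨y, hy⟩, Subtype.ext hyx⟩

theorem augmentationZero_algebraMap (n : ℕ) (N₁ N₂ : ℤ) (x : (koszulComplex n N₁ N₂).X 0)
    (r : PolyRing n N₁ N₂) (hx : x.1 = algebraMap _ (KoszulAlgebra n N₁ N₂) r) :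
    augmentationZero n N₁ N₂ x = Ideal.Quotient.mk (relationIdeal n N₁ N₂) r := by
  change augmentation n N₁ N₂ x.1 = _
  rw [hx, AlgHom.commutes]
  rfl

theorem exists_algebraMap_eq (n : ℕ) (N₁ N₂ : ℤ) (x : (koszulComplex n N₁ N₂).X 0) :
    ∃ r : PolyRing n N₁ N₂, x.1 = algebraMap _ (KoszulAlgebra n N₁ N₂) r := by
  have h : (x.1 : KoszulAlgebra n N₁ N₂) ∈ (1 : Submodule (PolyRing n N₁ N₂) _) :=
    (pow_zero (LinearMap.range (ExteriorAlgebra.ι (PolyRing n N₁ N₂)))).le x.2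
  obtain ⟨r, hr⟩ := Submodule.mem_one.1 h
  exact ⟨r, hr.symm⟩

theorem d_comp_augmentationZero (n : ℕ) (N₁ N₂ : ℤ) :
    (koszulComplex n N₁ N₂).d 1 0 ≫ augmentationZero n N₁ N₂ = 0 := by
  have hd : (koszulComplex n N₁ N₂).d 1 0 = ModuleCat.ofHom (differentialComponent n N₁ N₂ 0) :=
    koszulComplex_d n N₁ N₂ 0
  refine ModuleCat.hom_ext (LinearMap.ext fun x => ?_)
  rw [hd]
  have hx : (x.1 : KoszulAlgebra n N₁ N₂) ∈
      ExteriorAlgebra.coordPower (PolyRing n N₁ N₂) Set.univ 1 :=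
    (ExteriorAlgebra.coordPower_univ 1).ge x.2
  obtain ⟨r, hr, e⟩ := ExteriorAlgebra.exists_mem_span_koszulD_eq_smul_one
    (fun l : OddIndex N₁ N₂ => relation n N₁ N₂ l) _ hx
  refine (augmentationZero_algebraMap n N₁ N₂ (differentialComponent n N₁ N₂ 0 x) r ?_).trans ?_
  · rw [Algebra.algebraMap_eq_smul_one]
    exact e
  · rw [Set.image_univ] at hr
    exact Ideal.Quotient.eq_zero_iff_mem.2 hr

theorem exact_augmentationZero (n : ℕ) (N₁ N₂ : ℤ) :
    (ShortComplex.mk _ _ (d_comp_augmentationZero n N₁ N₂)).Exact := by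
  rw [ShortComplex.moduleCat_exact_iff]
  intro x hx
  obtain ⟨r, hr⟩ := exists_algebraMap_eq n N₁ N₂ x
  have hd : (koszulComplex n N₁ N₂).d 1 0 = ModuleCat.ofHom (differentialComponent n N₁ N₂ 0) :=
    koszulComplex_d n N₁ N₂ 0
  have h0 := (augmentationZero_algebraMap n N₁ N₂ x r hr).symm.trans hx
  have hmem : r ∈ Ideal.span ((fun l : OddIndex N₁ N₂ => relation n N₁ N₂ l) '' Set.univ) := by
    rw [Set.image_univ]
    exact Ideal.Quotient.eq_zero_iff_mem.1 h0
  obtain ⟨y, hy, e⟩ := ExteriorAlgebra.exists_koszulD_eq_smul_one _ _ hmem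
  rw [ExteriorAlgebra.coordPower_univ] at hy
  change ∃ y, (koszulComplex n N₁ N₂).d 1 0 y = x
  rw [hd]
  refine ⟨⟨y, hy⟩, Subtype.ext ?_⟩
  rw [hr, Algebra.algebraMap_eq_smul_one]
  exact e

theorem epi_augmentationZero (n : ℕ) (N₁ N₂ : ℤ) : Epi (augmentationZero n N₁ N₂) := by
  rw [ModuleCat.epi_iff_surjective]
  intro y
  obtain ⟨r, rfl⟩ := Ideal.Quotient.mk_surjective y
  refine ⟨⟨algebraMap _ (KoszulAlgebra n N₁ N₂) r, ?_⟩, augmentationZero_algebraMap n N₁ N₂ _ r rfl⟩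
  rw [ExteriorAlgebra.exteriorPower, pow_zero, Submodule.mem_one]
  exact ⟨r, rfl⟩

/-- In degree zero everything is a cycle, so `iCycles 0` is invertible. Both objects are then
cokernels of the map from degree one to the cycles, and uniqueness of cokernels gives the
isomorphism together with its compatibility. -/
theorem exists_homology_zero_iso (n : ℕ) (N₁ N₂ : ℤ) :
    ∃ e : (koszulComplex n N₁ N₂).homology 0 ≅ ModuleCat.of (PolyRing n N₁ N₂) (AQ n N₁ N₂),
      (koszulComplex n N₁ N₂).homologyπ 0 ≫ e.hom =
        (koszulComplex n N₁ N₂).iCycles 0 ≫ augmentationZero n N₁ N₂ := by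
  set K := koszulComplex n N₁ N₂
  have hiso : IsIso (K.iCycles 0) :=
    K.isIso_iCycles 0 0 ChainComplex.next_nat_zero (K.shape _ _ (by simp))
  have hepi := epi_augmentationZero n N₁ N₂
  have hzero : K.toCycles 1 0 ≫ K.iCycles 0 ≫ augmentationZero n N₁ N₂ = 0 := by
    rw [← Category.assoc, K.toCycles_i]
    exact d_comp_augmentationZero n N₁ N₂
  let S := ShortComplex.mk _ _ hzero
  have hS : S.Exact := by
    refine (ShortComplex.exact_iff_of_iso (S₁ := S)
      (S₂ := ShortComplex.mk _ _ (d_comp_augmentationZero n N₁ N₂))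
      (ShortComplex.isoMk (Iso.refl _) (asIso (K.iCycles 0)) (Iso.refl _) ?_ ?_)).2
      (exact_augmentationZero n N₁ N₂)
    · simp [S, K]
    · simp [S]
  have hg : Epi S.g := epi_comp _ _
  refine ⟨(K.homologyIsCokernel 1 0 (by simp)).coconePointUniqueUpToIso hS.gIsCokernel, ?_⟩
  exact Limits.IsColimit.comp_coconePointUniqueUpToIso_hom
    (K.homologyIsCokernel 1 0 (by simp)) hS.gIsCokernel Limits.WalkingParallelPair.one

/-! ### Isotropic coordinates -/

open MvPolynomial

/-- The substitution that turns `x₀² + x₁²` into `4 x₀ x₁` and fixes the other variables. -/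
noncomputable def isotropicHom (m : ℕ) (N₁ N₂ : ℤ) :
    PolyRing (m + 3) N₁ N₂ →ₐ[ℂ] PolyRing (m + 3) N₁ N₂ :=
  aeval fun p =>
    if p.1 = 0 then X (0, p.2) + X (1, p.2)
    else if p.1 = 1 then C Complex.I * (X (0, p.2) - X (1, p.2)) else X p

/-- The inverse of `isotropicHom`. -/
noncomputable def isotropicInv (m : ℕ) (N₁ N₂ : ℤ) :
    PolyRing (m + 3) N₁ N₂ →ₐ[ℂ] PolyRing (m + 3) N₁ N₂ :=
  aeval fun p =>
    if p.1 = 0 then C (1 / 2) * (X (0, p.2) - C Complex.I * X (1, p.2))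
    else if p.1 = 1 then C (1 / 2) * (X (0, p.2) + C Complex.I * X (1, p.2)) else X p

theorem C_I_mul_C_I {σ : Type*} : (C Complex.I * C Complex.I : MvPolynomial σ ℂ) = -1 := by
  rw [← C_mul, Complex.I_mul_I, C_neg, C_1]

theorem two_mul_C_half {σ : Type*} : (2 * C (1 / 2) : MvPolynomial σ ℂ) = 1 := by
  have : (2 : MvPolynomial σ ℂ) = C 2 := (map_ofNat C 2).symm
  rw [this, ← C_mul]
  norm_num

theorem isotropicHom_comp_isotropicInv (m : ℕ) (N₁ N₂ : ℤ) :
    (isotropicHom m N₁ N₂).comp (isotropicInv m N₁ N₂) = AlgHom.id ℂ _ := by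
  refine MvPolynomial.algHom_ext fun ⟨i, a⟩ => ?_
  have hI := C_I_mul_C_I (σ := EvenIndex (m + 3) N₁ N₂)
  have h2 := two_mul_C_half (σ := EvenIndex (m + 3) N₁ N₂)
  rw [AlgHom.comp_apply, AlgHom.id_apply, isotropicInv, aeval_X]
  rcases eq_or_ne i 0 with rfl | h0
  · simp only [isotropicHom, if_true, map_mul, map_sub, aeval_X, algHom_C, algebraMap_eq,
      one_ne_zero, if_false]
    linear_combination (-C (1 / 2) * (X (0, a) - X (1, a))) * hI + X (0, a) * h2
  rcases eq_or_ne i 1 with rfl | h1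
  · simp only [isotropicHom, if_true, map_mul, map_add, aeval_X, algHom_C, algebraMap_eq,
      one_ne_zero, if_false]
    linear_combination (C (1 / 2) * (X (0, a) - X (1, a))) * hI + X (1, a) * h2
  · simp only [isotropicHom, h0, h1, if_false, aeval_X]

theorem isotropicInv_comp_isotropicHom (m : ℕ) (N₁ N₂ : ℤ) :
    (isotropicInv m N₁ N₂).comp (isotropicHom m N₁ N₂) = AlgHom.id ℂ _ := by
  refine MvPolynomial.algHom_ext fun ⟨i, a⟩ => ?_
  have hI := C_I_mul_C_I (σ := EvenIndex (m + 3) N₁ N₂)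
  have h2 := two_mul_C_half (σ := EvenIndex (m + 3) N₁ N₂)
  rw [AlgHom.comp_apply, AlgHom.id_apply, isotropicHom, aeval_X]
  rcases eq_or_ne i 0 with rfl | h0
  · simp only [isotropicInv, if_true, map_add, aeval_X, one_ne_zero, if_false]
    linear_combination X (0, a) * h2
  rcases eq_or_ne i 1 with rfl | h1
  · simp only [isotropicInv, if_true, map_mul, map_sub, aeval_X, algHom_C, algebraMap_eq,
      one_ne_zero, if_false]
    linear_combination (-2 * C (1 / 2) * X (1, a)) * hI + X (1, a) * h2
  · simp only [isotropicInv, h0, h1, if_false, aeval_X]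

/-- The linear change of variables that turns `x₀² + x₁²` into `4 x₀ x₁`. -/
noncomputable def isotropicEquiv (m : ℕ) (N₁ N₂ : ℤ) :
    PolyRing (m + 3) N₁ N₂ ≃ₐ[ℂ] PolyRing (m + 3) N₁ N₂ :=
  AlgEquiv.ofAlgHom (isotropicHom m N₁ N₂) (isotropicInv m N₁ N₂)
    (isotropicHom_comp_isotropicInv m N₁ N₂) (isotropicInv_comp_isotropicHom m N₁ N₂)

/-- The Fourier mode of the quadric `4 x₀ x₁ + ∑_{i ≥ 2} x_i²`. -/
noncomputable def isotropicRelation (m : ℕ) (N₁ N₂ : ℤ) (l : ℤ) : PolyRing (m + 3) N₁ N₂ :=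
  ∑ s : Set.Icc (-N₁) N₂, ∑ t : Set.Icc (-N₁) N₂,
    if (s : ℤ) + (t : ℤ) = l then
      4 * (X (0, s) * X (1, t)) + (X (2, s) * X (2, t) +
        ∑ i : Fin m, X (i.succ.succ.succ, s) * X (i.succ.succ.succ, t))
    else 0

theorem isotropicEquiv_relation (m : ℕ) (N₁ N₂ : ℤ) (l : ℤ) :
    isotropicEquiv m N₁ N₂ (relation (m + 3) N₁ N₂ l) = isotropicRelation m N₁ N₂ l := by
  have hI := C_I_mul_C_I (σ := EvenIndex (m + 3) N₁ N₂)
  -- The substituted summand has cross terms `2 x₀[s] x₁[t] + 2 x₁[s] x₀[t]`. They merge into `4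
  -- x₀[s] x₁[t]` only after exchanging `s` and `t` in the double sum.
  let A (s t : Set.Icc (-N₁) N₂) : PolyRing (m + 3) N₁ N₂ :=
    if (s : ℤ) + (t : ℤ) = l then 2 * (X (0, s) * X (1, t)) else 0
  let B (s t : Set.Icc (-N₁) N₂) : PolyRing (m + 3) N₁ N₂ :=
    if (s : ℤ) + (t : ℤ) = l then X (2, s) * X (2, t) +
        ∑ i : Fin m, X (i.succ.succ.succ, s) * X (i.succ.succ.succ, t) else 0
  have h0 (s : Set.Icc (-N₁) N₂) :
      isotropicEquiv m N₁ N₂ (X (0, s)) = X (0, s) + X (1, s) := by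
    simp [isotropicEquiv, isotropicHom]
  have h1 (s : Set.Icc (-N₁) N₂) :
      isotropicEquiv m N₁ N₂ (X (1, s)) = C Complex.I * (X (0, s) - X (1, s)) := by
    simp [isotropicEquiv, isotropicHom]
  have hi (i : Fin (m + 1)) (s : Set.Icc (-N₁) N₂) :
      isotropicEquiv m N₁ N₂ (X (i.succ.succ, s)) = X (i.succ.succ, s) := by
    have : i.succ.succ ≠ 1 := fun h => Fin.succ_ne_zero i (Fin.succ_injective _ h)
    simp [isotropicEquiv, isotropicHom, this]
  have hL : isotropicEquiv m N₁ N₂ (relation (m + 3) N₁ N₂ l) =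
      ∑ s, ∑ t, (A s t + A t s + B s t) := by
    simp only [relation, map_sum]
    refine Finset.sum_congr rfl fun s _ => Finset.sum_congr rfl fun t _ => ?_
    simp only [A, B, add_comm (t : ℤ) s]
    split_ifs with h
    · rw [Fin.sum_univ_succ, Fin.sum_univ_succ, Fin.sum_univ_succ]
      simp only [map_add, map_mul, map_sum, hi]
      have e1 : (Fin.succ 0 : Fin (m + 3)) = 1 := rfl
      have e2 : (Fin.succ (Fin.succ 0) : Fin (m + 3)) = 2 := rfl
      have h2 := hi 0
      rw [e2] at h2
      rw [e1, e2, h0, h0, h1, h1]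
      linear_combination ((X (0, s) - X (1, s)) * (X (0, t) - X (1, t))) * hI
    · simp
  have hR : isotropicRelation m N₁ N₂ l = ∑ s, ∑ t, (A s t + A s t + B s t) := by
    refine Finset.sum_congr rfl fun s _ => Finset.sum_congr rfl fun t _ => ?_
    simp only [A, B]
    split_ifs
    · ring
    · simp
  rw [hL, hR]
  simp only [Finset.sum_add_distrib]
  rw [Finset.sum_comm (f := fun s t => A t s)]

/-! ### Leading monomials of the relations -/

/-- The index `l` for which the variable occurs in the leading monomial of `isotropicRelation l`. -/
def leadIndex {m : ℕ} {N₁ N₂ : ℤ} (p : EvenIndex (m + 3) N₁ N₂) : ℤ :=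
  2 * (p.2 : ℤ) + if p.1 = 0 then 1 else if p.1 = 1 then -1 else 0

/-- The negative weight of a variable. -/
def cost {m : ℕ} {N₁ N₂ : ℤ} (p : EvenIndex (m + 3) N₁ N₂) : ℤ :=
  leadIndex p ^ 2 + if p.1 ≤ 2 then 0 else 1

theorem exists_cost_le (m : ℕ) (N₁ N₂ : ℤ) :
    ∃ c : ℤ, ∀ p : EvenIndex (m + 3) N₁ N₂, cost p ≤ c := by
  obtain ⟨c, hc⟩ := (Set.finite_range (cost (m := m) (N₁ := N₁) (N₂ := N₂))).bddAbove
  exact ⟨c, fun p => hc ⟨p, rfl⟩⟩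

/-- The weight with which the leading monomials of the `isotropicRelation l` are coprime. -/
noncomputable def costWeight (m : ℕ) (N₁ N₂ : ℤ) : (EvenIndex (m + 3) N₁ N₂ →₀ ℕ) →+ ℕ :=
  Finsupp.weight fun p => ((exists_cost_le m N₁ N₂).choose - cost p).toNat

/-- The shift by an upper bound for `cost` makes the weight a natural number. All monomials compared
have degree two, so the shift contributes the same constant to each, and larger weight means smaller
cost. -/
theorem costWeight_single_add_single {m : ℕ} {N₁ N₂ : ℤ} (p q : EvenIndex (m + 3) N₁ N₂) :
    (costWeight m N₁ N₂ (Finsupp.single p 1 + Finsupp.single q 1) : ℤ) =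
      2 * (exists_cost_le m N₁ N₂).choose - cost p - cost q := by
  have h := (exists_cost_le m N₁ N₂).choose_spec
  rw [costWeight, map_add, Finsupp.weight_single, Finsupp.weight_single, one_smul, one_smul,
    Nat.cast_add, Int.toNat_of_nonneg (sub_nonneg.2 (h p)),
    Int.toNat_of_nonneg (sub_nonneg.2 (h q))]
  ring

/-- The polynomials all of whose monomials have smaller weight than the leading monomial of
`isotropicRelation l`. -/
noncomputable def lowerTerms (m : ℕ) (N₁ N₂ : ℤ) (l : ℤ) :
    Submodule ℂ (PolyRing (m + 3) N₁ N₂) :=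
  restrictSupport ℂ
    {a | (costWeight m N₁ N₂ a : ℤ) < 2 * (exists_cost_le m N₁ N₂).choose - 2 * l ^ 2}

/-- With indices `a + b = 2l`, the sum `a² + b²` exceeds `2l²` by `2(a - l)²`. The cost is strictly
larger than `2l²` either for this reason or because of the penalty on `p`. -/
theorem X_mul_X_mem_lowerTerms {m : ℕ} {N₁ N₂ : ℤ} {l : ℤ} {p q : EvenIndex (m + 3) N₁ N₂}
    (h : leadIndex p + leadIndex q = 2 * l) (h' : leadIndex p ≠ l ∨ ¬ p.1 ≤ 2) :
    (X p * X q : PolyRing (m + 3) N₁ N₂) ∈ lowerTerms m N₁ N₂ l := by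
  rw [lowerTerms, mem_restrictSupport_iff]
  intro a ha
  have hX : (X p * X q : PolyRing (m + 3) N₁ N₂) =
      monomial (Finsupp.single p 1 + Finsupp.single q 1) 1 := by
    rw [X, X, monomial_mul, one_mul]
  rw [hX] at ha
  have ha' := Finset.mem_singleton.1 (support_monomial_subset ha)
  rw [Set.mem_ofPred_eq, ha', costWeight_single_add_single]
  have hp : leadIndex p ^ 2 ≤ cost p := by rw [cost]; split_ifs <;> simp
  have hq : leadIndex q ^ 2 ≤ cost q := by rw [cost]; split_ifs <;> simp
  have hq' : leadIndex q = 2 * l - leadIndex p := by linarith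
  rw [hq'] at hq
  rcases h' with h' | h'
  · have : 0 < (leadIndex p - l) ^ 2 := by positivity [sub_ne_zero.2 h']
    nlinarith
  · have hp' : cost p = leadIndex p ^ 2 + 1 := by rw [cost, if_neg h']
    nlinarith [sq_nonneg (leadIndex p - l)]

/-- The leading variables of `isotropicRelation l` and its leading coefficient. -/
theorem exists_isotropicRelation_sub_mem (m : ℕ) (N₁ N₂ : ℤ) (l : OddIndex N₁ N₂) :
    ∃ (p q : EvenIndex (m + 3) N₁ N₂) (c : ℂ), c ≠ 0 ∧ p.1 ≤ 2 ∧ q.1 ≤ 2 ∧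
      leadIndex p = l ∧ leadIndex q = l ∧
      isotropicRelation m N₁ N₂ l - C c * (X p * X q) ∈ lowerTerms m N₁ N₂ l := by
  obtain ⟨l, hl1, hl2⟩ := l
  have hv : ((2 : Fin (m + 3)) : ℕ) = 2 := Nat.mod_eq_of_lt (show 2 < m + 3 by omega)
  have h20 : (2 : Fin (m + 3)) ≠ 0 := fun h => by
    have h' := congrArg Fin.val h
    rw [hv] at h'
    simp at h'
  have h21 : (2 : Fin (m + 3)) ≠ 1 := fun h => by
    have h' := congrArg Fin.val h
    rw [hv] at h'
    simp at h'
  have h0 (s : Set.Icc (-N₁) N₂) : leadIndex ((0, s) : EvenIndex (m + 3) N₁ N₂) = 2 * s + 1 := by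
    simp [leadIndex]
  have h1 (s : Set.Icc (-N₁) N₂) : leadIndex ((1, s) : EvenIndex (m + 3) N₁ N₂) = 2 * s - 1 := by
    simp [leadIndex, sub_eq_add_neg]
  have h2 (s : Set.Icc (-N₁) N₂) : leadIndex ((2, s) : EvenIndex (m + 3) N₁ N₂) = 2 * s := by
    simp [leadIndex, h20, h21]
  have h3 (i : Fin m) (s : Set.Icc (-N₁) N₂) :
      leadIndex ((i.succ.succ.succ, s) : EvenIndex (m + 3) N₁ N₂) = 2 * s := by
    have : i.succ.succ.succ ≠ 1 := fun h => Fin.succ_ne_zero _ (Fin.succ_injective _ h)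
    simp [leadIndex, this]
  have h3' (i : Fin m) : ¬ i.succ.succ.succ ≤ 2 := by
    rw [Fin.le_def, hv]
    simp
  have hmul (c : ℂ) {f : PolyRing (m + 3) N₁ N₂} (hf : f ∈ lowerTerms m N₁ N₂ l) :
      C c * f ∈ lowerTerms m N₁ N₂ l := by
    rw [C_mul']
    exact Submodule.smul_mem _ _ hf
  have h4 : (4 : PolyRing (m + 3) N₁ N₂) = C 4 := (map_ofNat C 4).symm
  have huv (s t : Set.Icc (-N₁) N₂) (hst : (s : ℤ) + t = l) (hs : 2 * (s : ℤ) + 1 ≠ l) :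
      (4 * (X (0, s) * X (1, t)) : PolyRing (m + 3) N₁ N₂) ∈ lowerTerms m N₁ N₂ l := by
    rw [h4]
    refine hmul 4 (X_mul_X_mem_lowerTerms ?_ (Or.inl ?_))
    · rw [h0, h1]; linarith
    · rwa [h0]
  have hzz (s t : Set.Icc (-N₁) N₂) (hst : (s : ℤ) + t = l) (hs : 2 * (s : ℤ) ≠ l) :
      (X (2, s) * X (2, t) : PolyRing (m + 3) N₁ N₂) ∈ lowerTerms m N₁ N₂ l := by
    refine X_mul_X_mem_lowerTerms ?_ (Or.inl ?_)
    · rw [h2, h2]; linarith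
    · rwa [h2]
  have hww (s t : Set.Icc (-N₁) N₂) (hst : (s : ℤ) + t = l) :
      (∑ i : Fin m, X (i.succ.succ.succ, s) * X (i.succ.succ.succ, t) : PolyRing (m + 3) N₁ N₂) ∈
        lowerTerms m N₁ N₂ l := by
    refine Submodule.sum_mem _ fun i _ => X_mul_X_mem_lowerTerms ?_ (Or.inr (h3' i))
    rw [h3, h3]; linarith
  -- Spreads the leading monomial over the double sum, so that it can be subtracted from the
  -- relation term by term.
  have hsplit (s₀ t₀ : Set.Icc (-N₁) N₂) (M : PolyRing (m + 3) N₁ N₂) :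
      M = ∑ s : Set.Icc (-N₁) N₂, ∑ t : Set.Icc (-N₁) N₂, if s = s₀ ∧ t = t₀ then M else 0 := by
    simp [ite_and]
  rcases Int.even_or_odd' l with ⟨a, ha | ha⟩
  · let s₀ : Set.Icc (-N₁) N₂ := ⟨a, by constructor <;> linarith⟩
    refine ⟨(2, s₀), (2, s₀), 1, one_ne_zero, le_rfl, le_rfl, ?_, ?_, ?_⟩
    · rw [h2]; exact ha.symm
    · rw [h2]; exact ha.symm
    rw [hsplit s₀ s₀ (C 1 * _), isotropicRelation, ← Finset.sum_sub_distrib]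
    refine Submodule.sum_mem _ fun s _ => ?_
    rw [← Finset.sum_sub_distrib]
    refine Submodule.sum_mem _ fun t _ => ?_
    by_cases hst : (s : ℤ) + t = l
    · have hs : 2 * (s : ℤ) + 1 ≠ l := by omega
      rw [if_pos hst, add_sub_assoc]
      refine Submodule.add_mem _ (huv s t hst hs) ?_
      by_cases h : s = s₀ ∧ t = s₀
      · rw [if_pos h, h.1, h.2, C_1, one_mul, add_sub_cancel_left]
        refine hww _ _ ?_
        rw [← hst, h.1, h.2]
      · rw [if_neg h, sub_zero]
        refine Submodule.add_mem _ (hzz s t hst fun e => h ?_) (hww s t hst)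
        exact ⟨Subtype.ext (by change (s : ℤ) = a; omega),
          Subtype.ext (by change (t : ℤ) = a; omega)⟩
    · have h : ¬ (s = s₀ ∧ t = s₀) := by
        rintro ⟨rfl, rfl⟩
        exact hst (by change a + a = l; omega)
      rw [if_neg hst, if_neg h, sub_zero]
      exact Submodule.zero_mem _
  · let s₀ : Set.Icc (-N₁) N₂ := ⟨a, by constructor <;> omega⟩
    -- The bound `a + 1 ≤ N₂` uses parity: an odd `l ≤ 2 * N₂` is strictly smaller than `2 * N₂`.
    let t₀ : Set.Icc (-N₁) N₂ := ⟨a + 1, by constructor <;> omega⟩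
    refine ⟨(0, s₀), (1, t₀), 4, by norm_num, Fin.zero_le _,
      by rw [Fin.le_def, hv]; simp,
      ?_, ?_, ?_⟩
    · rw [h0]; exact ha.symm
    · rw [h1]; change 2 * (a + 1) - 1 = l; omega
    rw [hsplit s₀ t₀ (C 4 * _), isotropicRelation, ← Finset.sum_sub_distrib]
    refine Submodule.sum_mem _ fun s _ => ?_
    rw [← Finset.sum_sub_distrib]
    refine Submodule.sum_mem _ fun t _ => ?_
    by_cases hst : (s : ℤ) + t = l
    · have hs : 2 * (s : ℤ) ≠ l := by omega
      rw [if_pos hst, add_sub_right_comm]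
      refine Submodule.add_mem _ ?_ (Submodule.add_mem _ (hzz s t hst hs) (hww s t hst))
      by_cases h : s = s₀ ∧ t = t₀
      · rw [if_pos h, h.1, h.2, h4, sub_self]
        exact Submodule.zero_mem _
      · rw [if_neg h, sub_zero]
        refine huv s t hst fun e => h ?_
        exact ⟨Subtype.ext (by change (s : ℤ) = a; omega),
          Subtype.ext (by change (t : ℤ) = a + 1; omega)⟩
    · have h : ¬ (s = s₀ ∧ t = t₀) := by
        rintro ⟨rfl, rfl⟩
        exact hst (by change a + (a + 1) = l; omega)
      rw [if_neg hst, if_neg h, sub_zero]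
      exact Submodule.zero_mem _

theorem exists_degree_isotropicRelation {m : ℕ} {N₁ N₂ : ℤ}
    (mo : MonomialOrder (EvenIndex (m + 3) N₁ N₂)) (l : OddIndex N₁ N₂) :
    ∃ p q : EvenIndex (m + 3) N₁ N₂, leadIndex p = l ∧ leadIndex q = l ∧
      (mo.weighted (costWeight m N₁ N₂)).degree (isotropicRelation m N₁ N₂ l) =
        Finsupp.single p 1 + Finsupp.single q 1 := by
  obtain ⟨p, q, c, hc, hp2, hq2, hp, hq, h⟩ := exists_isotropicRelation_sub_mem m N₁ N₂ l
  refine ⟨p, q, hp, hq, MonomialOrder.degree_eq_of_sub_monomial _ hc fun a ha => ?_⟩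
  refine MonomialOrder.weighted_lt_of_lt _ _ ?_
  rw [X, X, monomial_mul, one_mul, C_mul_monomial, mul_one, lowerTerms,
    mem_restrictSupport_iff] at h
  have := h ha
  rw [Set.mem_ofPred_eq] at this
  have hpq := costWeight_single_add_single p q
  rw [cost, cost, if_pos hp2, if_pos hq2, hp, hq] at hpq
  zify
  linarith

/-- A variable `r` can divide the leading monomial only of the relation numbered `leadIndex r`. -/
theorem pairwise_disjoint_degree_isotropicRelation {m : ℕ} {N₁ N₂ : ℤ}
    (mo : MonomialOrder (EvenIndex (m + 3) N₁ N₂)) :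
    Pairwise fun l l' : OddIndex N₁ N₂ => Disjoint
      ((mo.weighted (costWeight m N₁ N₂)).degree (isotropicRelation m N₁ N₂ l))
      ((mo.weighted (costWeight m N₁ N₂)).degree (isotropicRelation m N₁ N₂ l')) := by
  classical
  intro l l' hne
  obtain ⟨p, q, hp, hq, e⟩ := exists_degree_isotropicRelation mo l
  obtain ⟨p', q', hp', hq', e'⟩ := exists_degree_isotropicRelation mo l'
  rw [e, e', disjoint_iff]
  ext r
  simp only [Finsupp.inf_apply, Finsupp.add_apply, _root_.bot_eq_zero, Finsupp.coe_zero,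
    Pi.zero_apply]
  by_cases hr : leadIndex r = l
  · have h1 : p' ≠ r := fun h => hne (Subtype.ext (by rw [← hr, ← hp', h]))
    have h2 : q' ≠ r := fun h => hne (Subtype.ext (by rw [← hr, ← hq', h]))
    simp [Finsupp.single_apply, h1, h2]
  · have h1 : p ≠ r := fun h => hr (by rw [← hp, h])
    have h2 : q ≠ r := fun h => hr (by rw [← hq, h])
    simp [Finsupp.single_apply, h1, h2]

theorem isotropicRelation_ne_zero (m : ℕ) (N₁ N₂ : ℤ) (l : OddIndex N₁ N₂) :
    isotropicRelation m N₁ N₂ l ≠ 0 := by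
  obtain ⟨mo⟩ := MonomialOrder.exists_of_finite (EvenIndex (m + 3) N₁ N₂)
  obtain ⟨p, q, -, -, e⟩ := exists_degree_isotropicRelation mo l
  refine MonomialOrder.ne_zero_of_degree_ne_zero (m := mo.weighted (costWeight m N₁ N₂)) ?_
  rw [e]
  intro h
  have := DFunLike.congr_fun h p
  simp at this

/-- The relations form a regular sequence in every order. -/
theorem mem_span_of_mul_relation_mem (n : ℕ) (hn : 3 ≤ n) (N₁ N₂ : ℤ)
    (s : Finset (OddIndex N₁ N₂)) (j : OddIndex N₁ N₂) (hj : j ∉ s) (g : PolyRing n N₁ N₂)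
    (hg : g * relation n N₁ N₂ j ∈
      Ideal.span ((fun l : OddIndex N₁ N₂ => relation n N₁ N₂ l) '' s)) :
    g ∈ Ideal.span ((fun l : OddIndex N₁ N₂ => relation n N₁ N₂ l) '' s) := by
  obtain ⟨m, rfl⟩ := Nat.exists_eq_add_of_le' hn
  obtain ⟨mo⟩ := MonomialOrder.exists_of_finite (EvenIndex (m + 3) N₁ N₂)
  -- Ideal membership is transported along the change of variables, under which generators
  -- correspond to generators.
  have key (f : PolyRing (m + 3) N₁ N₂) :
      f ∈ Ideal.span ((fun l : OddIndex N₁ N₂ => relation (m + 3) N₁ N₂ l) '' s) ↔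
      isotropicEquiv m N₁ N₂ f ∈
        Ideal.span ((fun l : OddIndex N₁ N₂ => isotropicRelation m N₁ N₂ l) '' s) := by
    have h : Ideal.span ((fun l : OddIndex N₁ N₂ => isotropicRelation m N₁ N₂ l) '' s) =
        Ideal.map (isotropicEquiv m N₁ N₂).toRingEquiv
          (Ideal.span ((fun l : OddIndex N₁ N₂ => relation (m + 3) N₁ N₂ l) '' s)) := by
      rw [Ideal.map_span, Set.image_image]
      congr 1
      exact Set.image_congr fun l _ => (isotropicEquiv_relation m N₁ N₂ l).symm
    rw [h, Ideal.mem_map_of_equiv]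
    refine ⟨fun hf => ⟨f, hf, rfl⟩, ?_⟩
    rintro ⟨f', hf', e⟩
    rwa [← (isotropicEquiv m N₁ N₂).injective e]
  rw [key, map_mul, isotropicEquiv_relation] at hg
  rw [key]
  exact MonomialOrder.mem_span_of_mul_mem_span (mo.weighted (costWeight m N₁ N₂))
    (isotropicRelation_ne_zero m N₁ N₂) (pairwise_disjoint_degree_isotropicRelation mo) s hj hg

/-! ### The regular sequence and the conclusion -/

/-- No relation has a constant term. Properness of the ideal is the nontriviality of the quotient
required of a regular sequence, beyond weak regularity. -/
theorem relationIdeal_ne_top (n : ℕ) (N₁ N₂ : ℤ) : relationIdeal n N₁ N₂ ≠ ⊤ := by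
  have h : relationIdeal n N₁ N₂ ≤ RingHom.ker (constantCoeff (R := ℂ)) := by
    rw [relationIdeal, Ideal.span_le]
    rintro _ ⟨l, rfl⟩
    rw [SetLike.mem_coe, RingHom.mem_ker]
    simp only [relation, map_sum]
    refine Finset.sum_eq_zero fun s _ => Finset.sum_eq_zero fun t _ => ?_
    split_ifs <;> simp
  intro h1
  rw [h1, top_le_iff] at h
  exact RingHom.ker_ne_top _ h

theorem isRegular_relationList (n : ℕ) (N₁ N₂ : ℤ)
    (H : ∀ (s : Finset (OddIndex N₁ N₂)) (j : OddIndex N₁ N₂), j ∉ s → ∀ g : PolyRing n N₁ N₂,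
      g * relation n N₁ N₂ j ∈ Ideal.span ((fun l : OddIndex N₁ N₂ => relation n N₁ N₂ l) '' s) →
      g ∈ Ideal.span ((fun l : OddIndex N₁ N₂ => relation n N₁ N₂ l) '' s)) :
    RingTheory.Sequence.IsRegular (PolyRing n N₁ N₂) (relationList n N₁ N₂) := by
  classical
  have hlen : (relationList n N₁ N₂).length = (2 * (N₁ + N₂) + 1).toNat := by
    rw [relationList, List.length_ofFn]
  have hget (i : ℕ) (hi : i < (relationList n N₁ N₂).length) :
      (relationList n N₁ N₂)[i] = relation n N₁ N₂ (-2 * N₁ + i) := by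
    simp [relationList]
  have hodd (i : ℕ) (hi : i < (relationList n N₁ N₂).length) :
      -2 * N₁ + i ∈ Set.Icc (-2 * N₁) (2 * N₂) := by
    rw [hlen] at hi
    constructor <;> omega
  -- The first `i` entries of the list are the relations with `l < -2 * N₁ + i`. The next entry has
  -- `l = -2 * N₁ + i`, just outside this set, so `H` applies to it.
  have hspan (i : ℕ) (hi : i ≤ (relationList n N₁ N₂).length) :
      Ideal.ofList ((relationList n N₁ N₂).take i) =
        Ideal.span ((fun l : OddIndex N₁ N₂ => relation n N₁ N₂ l) ''
          (Finset.univ.filter fun l : OddIndex N₁ N₂ => (l : ℤ) < -2 * N₁ + i)) := by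
    rw [Ideal.ofList]
    congr 1
    ext f
    simp only [Set.mem_ofPred_eq, List.mem_take_iff_getElem, Finset.coe_filter, Finset.mem_univ,
      true_and, Set.mem_image]
    constructor
    · rintro ⟨j, hj, rfl⟩
      have hj' := lt_min_iff.1 hj
      refine ⟨⟨_, hodd j hj'.2⟩, ?_, (hget j hj'.2).symm⟩
      change -2 * N₁ + (j : ℤ) < _
      omega
    · rintro ⟨⟨l, hl1, hl2⟩, hl, rfl⟩
      have hl' : l < -2 * N₁ + i := hl
      have hj : (l + 2 * N₁).toNat < min i (relationList n N₁ N₂).length :=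
        lt_min (by omega) (by omega)
      refine ⟨(l + 2 * N₁).toNat, hj, ?_⟩
      rw [hget _ (lt_min_iff.1 hj).2]
      congr 1
      change _ = l
      omega
  refine ⟨⟨fun i hi => ?_⟩, ?_⟩
  · rw [isSMulRegular_quotient_iff_mem_of_smul_mem]
    intro g hg
    rw [smul_eq_mul, Ideal.mul_top, hspan i hi.le] at hg ⊢
    rw [hget i hi, smul_eq_mul, mul_comm (relation n N₁ N₂ _)] at hg
    exact H _ ⟨_, hodd i hi⟩ (by simp) g hg
  · rw [smul_eq_mul, Ideal.mul_top, ← (relationList n N₁ N₂).take_length, hspan _ le_rfl]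
    refine ne_of_gt (lt_of_le_of_lt (Ideal.span_mono ?_) (relationIdeal_ne_top n N₁ N₂).lt_top)
    exact Set.image_subset_range _ _

end Quasimap

theorem mainTheorem1 (n : ℕ) (hn : 3 ≤ n) (N₁ N₂ : ℤ) (hN : -N₁ ≤ N₂) :
    (∀ p : ℕ, p ≠ 0 →
      CategoryTheory.Limits.IsZero ((Quasimap.koszulComplex n N₁ N₂).homology p)) ∧
    (∃ e : (Quasimap.koszulComplex n N₁ N₂).homology 0 ≅
        ModuleCat.of (Quasimap.PolyRing n N₁ N₂) (Quasimap.AQ n N₁ N₂),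
      (Quasimap.koszulComplex n N₁ N₂).homologyπ 0 ≫ e.hom =
        (Quasimap.koszulComplex n N₁ N₂).iCycles 0 ≫ Quasimap.augmentationZero n N₁ N₂) ∧
    RingTheory.Sequence.IsRegular (Quasimap.PolyRing n N₁ N₂)
      (Quasimap.relationList n N₁ N₂) := by
  have H := Quasimap.mem_span_of_mul_relation_mem n hn N₁ N₂
  exact ⟨Quasimap.isZero_homology_koszulComplex n N₁ N₂ H,
    Quasimap.exists_homology_zero_iso n N₁ N₂, Quasimap.isRegular_relationList n N₁ N₂ H⟩
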